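/- **Setting.** Let $\Omega=\{1,\dots,Q\}$ and let $N\ge 1$. For $r,q\in\Omega$ let $(h_{rq}(l))_{l=0}^{L_h}$ be a complex FIR impulse response, $d_{rq}>0$ a distance, and $\gamma\in\mathbb R$ the path-loss exponent. The channel matrix $\mathbf H_{rq}\in\mathbb C^{N\times N}$ from source $r$ to destination $q$ is the circulant matrix of the cyclic convolution with $h_{rq}$ modulo $N$, divided by $\sqrt{d_{rq}^{\gamma}}$, and $\bar H_{rq}(k)=\sum_l h_{rq}(l)e^{-2\pi \mathrm i\, l(k-1)/N}$, $k=1,\dots,N$. Let $\mathbf W$ be the normalized IFFT matrix, $[\mathbf W]_{ij}=e^{2\pi \mathrm i(i-1)(j-1)/N}/\sqrt N$. Let $\sigma_q^2>0$ (noise variance), $P_q>0$ (power budget), $\overline p_q^{\max}(k)\ge 0$ (spectral mask) and $\Gamma_q\ge 1$ (gap). Put $\mathbf R_{-q}=\sigma_q^2\mathbf I+\sum_{r\ne q}\mathbf H_{rq}\mathbf F_r\mathbf F_r^H\mathbf H_{rq}^H$ and $\mathbf M_q=\mathbf I+\mathbf F_q^H\mathbf H_{qq}^H\mathbf R_{-q}^{-1}\mathbf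 H_{qq}\mathbf F_q$. In the matrix games $\mathscr G_1$ and $\mathscr G_2$ player $q\in\Omega$ chooses $\mathbf F_q$ in $$\mathscr F_q=\Big\{\mathbf F\in\mathbb C^{N\times N}:\tfrac1N\mathrm{Tr}(\mathbf F\mathbf F^H)\le P_q,\ [\mathbf W^H\mathbf F\mathbf F^H\mathbf W]_{kk}\le\overline p_q^{\max}(k)\ \ \forall k\Big\}.$$ The payoff in $\mathscr G_1$ is the mutual information $\frac1N\log\det\mathbf M_q$. The payoff in $\mathscr G_2$ is the gap-approximated rate $\frac1N\sum_{k}\log_2\big(1+\mathrm{SINR}_{k,q}/\Gamma_q\big)$, where $\mathrm{SINR}_{k,q}=1/[\mathbf M_q^{-1}]_{kk}-1$ is the SINR after the MMSE receiver. In the vector game $\mathscr G$ player $q$ chooses $\mathbf p_q$ in $$\mathscr P_q=\Big\{\mathbf p\in\mathbb R^N:\tfrac1N\sum_k p(k)\le 1,\ 0\le p(k)\le \overline p_q^{\max}(k)/P_q\ \ \forall k\Big\}$$ and has payoff $R_q(\mathbf p)=\frac1N\sum_k\log\big(1+\mathsf{sinr}_q(k)/\Gamma_q\big)$, where $$\mathsf{sinr}_q(k)=\frac{P_q|\bar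 H_{qq}(k)|^2p_q(k)/d_{qq}^\gamma}{\sigma_q^2+\sum_{r\ne q}P_r|\bar H_{rq}(k)|^2p_r(k)/d_{rq}^\gamma}.$$ Here $\log$ is the natural logarithm, and $\Gamma_q=1$ for all $q$ in $\mathscr G$ when it is compared with $\mathscr G_1$. A *solution* of a game is a pure-strategy Nash equilibrium; a *best response* of player $q$ in a profile is an admissible strategy of $q$ that maximizes the payoff of $q$ over all admissible strategies of $q$, those of the others being fixed. For $\mathbf p=(\mathbf p_q)_{q\in\Omega}$ with nonnegative entries put $$\mathbf F_q(\mathbf p_q)=\mathbf W\sqrt{P_q\,\mathrm{diag}(\mathbf p_q)},\qquad q\in\Omega .$$ **Theorem.** For every $\mathbf p$ with nonnegative entries, $\mathbf F_q(\mathbf p_q)\in\mathscr F_q$ if and only if $\mathbf p_q\in\mathscr P_q$. For every real $\mathbf p$, $$\mathsf{sinr}_q(k)=\frac{|H_{qq}(k)|^2p_q(k)}{1+\sum_{r\neq q}|H_{rq}(k)|^2p_r(k)},\qquad H_{rq}(k)=\bar H_{rq}(k)\sqrt{P_r/(\sigma_q^2d_{rq}^\gamma)}.$$ Moreover, for each of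 the games $\mathscr G_1$ and $\mathscr G_2$: 1. (Same payoffs.) For every $\mathbf p$ with nonnegative entries, the payoff of each user $q$ at $(\mathbf F_r(\mathbf p_r))_{r}$ is $R_q(\mathbf p)$ in $\mathscr G_1$, and $R_q(\mathbf p)/\log 2$ (that is, $R_q$ in bits) in $\mathscr G_2$. 2. (Optimal precoders.) For every $\mathbf p$ with nonnegative entries and every user $q$, the precoder $\mathbf F_q(\mathbf p_q)$ is a best response of $q$, among all precoding matrices in $\mathscr F_q$, to $(\mathbf F_r(\mathbf p_r))_{r\ne q}$ if and only if $\mathbf p_q$ is a best response to $(\mathbf p_r)_{r\neq q}$ in $\mathscr G$. If $\mathbf p_r\in\mathscr P_r$ for all $r$, then for every $q$ there is $\mathbf y\in\mathscr P_q$ which is a best response to $(\mathbf p_r)_{r\neq q}$ in $\mathscr G$, so that $\mathbf F_q(\mathbf y)$ is a best response to $(\mathbf F_r(\mathbf p_r))_{r\ne q}$ in the matrix game. 3. (Solutions.) For every $\mathbf p$ with nonnegative entries, $(\mathbf F_q(\mathbf p_q))_{q\in\Omega}$ is a solution of the matrix game if and only if $\mathbf p$ is a solution of $\mathscr G$. 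-/

import Mathlib

open scoped Matrix

/-- A strategic game with set of players `ι`, all of whose strategies live in a common type `A`:
`strategies q` is the admissible set of player `q` and `payoff q x` is what player `q` gets
under the strategy profile `x`. -/
structure StrategicGame (ι A : Type) where
  strategies : ι → Set A
  payoff : ι → (ι → A) → ℝ

/-- In the profile `x` player `q` plays an admissible strategy that is optimal against the
strategies that the other players have in `x`. -/
def StrategicGame.IsBestResponse {ι A : Type} [DecidableEq ι] (G : StrategicGame ι A)
    (x : ι → A) (q : ι) : Prop :=
  x q ∈ G.strategies q ∧
    ∀ y ∈ G.strategies q, G.payoff q (Function.update x q y) ≤ G.payoff q x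

/-- Pure-strategy Nash equilibrium. -/
def StrategicGame.IsNash {ι A : Type} [DecidableEq ι] (G : StrategicGame ι A)
    (x : ι → A) : Prop :=
  ∀ q, G.IsBestResponse x q

/-- The physical data of `Q` links which transmit blocks of length `N` over frequency-selective
channels. In arguments `r q`, `r` is the source and `q` the destination. -/
structure LinkSystem (Q N : ℕ) where
  /-- maximum order of the FIR channels -/
  order : ℕ
  /-- impulse response (normalized fading) of the channel from source `r` to destination `q` -/
  tap : Fin Q → Fin Q → Fin (order + 1) → ℂ
  /-- distance between source `r` and destination `q` -/
  dist : Fin Q → Fin Q → ℝ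
  dist_pos : ∀ r q, 0 < dist r q
  /-- path-loss exponent -/
  pathExp : ℝ
  /-- `noise q ^ 2` is the noise variance at destination `q` -/
  noise : Fin Q → ℝ
  noise_pos : ∀ q, 0 < noise q
  /-- power budget -/
  power : Fin Q → ℝ
  power_pos : ∀ q, 0 < power q
  /-- spectral mask, not normalized -/
  mask : Fin Q → Fin N → ℝ
  mask_nonneg : ∀ q k, 0 ≤ mask q k

noncomputable section

/-- The normalized IFFT matrix, with entries `exp (2 π i a b / N) / √N` for `a, b = 0, …, N - 1`. -/
def ifftMatrix (N : ℕ) : Matrix (Fin N) (Fin N) ℂ :=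
  Matrix.of fun a b =>
    Complex.exp (2 * Real.pi * Complex.I * (a : ℕ) * (b : ℕ) / N) / (Real.sqrt N : ℂ)

namespace LinkSystem

variable {Q N : ℕ}

/-- Path loss `d_rq ^ γ`. -/
def pathLoss (S : LinkSystem Q N) (r q : Fin Q) : ℝ := S.dist r q ^ S.pathExp

/-- The channel matrix left after insertion and removal of the cyclic prefix: the circulant matrix
of the cyclic convolution `x ↦ (i ↦ ∑ l, h l * x (i - l mod N))`, scaled by the path loss. -/
def channel (S : LinkSystem Q N) (r q : Fin Q) : Matrix (Fin N) (Fin N) ℂ :=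
  Matrix.of fun i j =>
    ∑ l : Fin (S.order + 1),
      if ((j : ℕ) + (l : ℕ)) ≡ (i : ℕ) [MOD N] then
        S.tap r q l / (Real.sqrt (S.pathLoss r q) : ℂ)
      else 0

/-- Frequency response of the normalized fading channel on the `k`-th frequency bin. -/
def freqResp (S : LinkSystem Q N) (r q : Fin Q) (k : Fin N) : ℂ :=
  ∑ l : Fin (S.order + 1),
    S.tap r q l * Complex.exp (-(2 * Real.pi * Complex.I * (l : ℕ) * (k : ℕ) / N))

/-- Interference-plus-noise covariance matrix observed by user `q` under the precoders `F`. -/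
def interfCov (S : LinkSystem Q N) (F : Fin Q → Matrix (Fin N) (Fin N) ℂ) (q : Fin Q) :
    Matrix (Fin N) (Fin N) ℂ :=
  ((S.noise q ^ 2 : ℝ) : ℂ) • (1 : Matrix (Fin N) (Fin N) ℂ) +
    ∑ r ∈ Finset.univ.erase q, S.channel r q * F r * (F r)ᴴ * (S.channel r q)ᴴ

/-- The matrix `I + F_qᴴ H_qqᴴ R_{-q}⁻¹ H_qq F_q`. -/
def gainMatrix (S : LinkSystem Q N) (F : Fin Q → Matrix (Fin N) (Fin N) ℂ) (q : Fin Q) :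
    Matrix (Fin N) (Fin N) ℂ :=
  1 + (F q)ᴴ * (S.channel q q)ᴴ * (S.interfCov F q)⁻¹ * S.channel q q * F q

/-- Mutual information of link `q`, the other users being treated as noise (the determinant
is a positive real number). -/
def mutualInfo (S : LinkSystem Q N) (F : Fin Q → Matrix (Fin N) (Fin N) ℂ) (q : Fin Q) : ℝ :=
  1 / N * Real.log (S.gainMatrix F q).det.re

/-- SINR of link `q` on the `k`-th substream after the MMSE (Wiener) receiver (the diagonal
entries of the inverse are positive real numbers). -/
def mmseSINR (S : LinkSystem Q N) (F : Fin Q → Matrix (Fin N) (Fin N) ℂ) (q : Fin Q)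
    (k : Fin N) : ℝ :=
  1 / ((S.gainMatrix F q)⁻¹ k k).re - 1

/-- Transmission rate of link `q`, in bits, under the gap approximation with gaps `Γ`. -/
def gapRate (S : LinkSystem Q N) (Γ : Fin Q → ℝ) (F : Fin Q → Matrix (Fin N) (Fin N) ℂ)
    (q : Fin Q) : ℝ :=
  1 / N * ∑ k, Real.logb 2 (1 + S.mmseSINR F q k / Γ q)

/-- Precoding matrices satisfying the transmit power and the spectral mask constraints. -/
def precoders (S : LinkSystem Q N) (q : Fin Q) : Set (Matrix (Fin N) (Fin N) ℂ) :=
  {F | 1 / N * (F * Fᴴ).trace.re ≤ S.power q ∧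
    ∀ k, (((ifftMatrix N)ᴴ * F * Fᴴ * ifftMatrix N) k k).re ≤ S.mask q k}

/-- The matrix game whose payoffs are the mutual informations. -/
def game1 (S : LinkSystem Q N) : StrategicGame (Fin Q) (Matrix (Fin N) (Fin N) ℂ) where
  strategies := S.precoders
  payoff := fun q F => S.mutualInfo F q

/-- The matrix game whose payoffs are the gap-approximated transmission rates. -/
def game2 (S : LinkSystem Q N) (Γ : Fin Q → ℝ) :
    StrategicGame (Fin Q) (Matrix (Fin N) (Fin N) ℂ) where
  strategies := S.precoders
  payoff := fun q F => S.gapRate Γ F q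

/-- The signal to interference-plus-noise ratio of user `q` on the `k`-th bin. -/
def sinr (S : LinkSystem Q N) (p : Fin Q → Fin N → ℝ) (q : Fin Q) (k : Fin N) : ℝ :=
  (S.power q * ‖S.freqResp q q k‖ ^ 2 * p q k / S.pathLoss q q) /
    (S.noise q ^ 2 + ∑ r ∈ Finset.univ.erase q,
      S.power r * ‖S.freqResp r q k‖ ^ 2 * p r k / S.pathLoss r q)

/-- The normalized channel `H_rq(k)`. -/
def normResp (S : LinkSystem Q N) (r q : Fin Q) (k : Fin N) : ℂ :=
  S.freqResp r q k * (Real.sqrt (S.power r / (S.noise q ^ 2 * S.pathLoss r q)) : ℂ)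

/-- Admissible (normalized) power allocations of user `q`. -/
def allocations (S : LinkSystem Q N) (q : Fin Q) : Set (Fin N → ℝ) :=
  {p | 1 / N * ∑ k, p k ≤ 1 ∧ ∀ k, 0 ≤ p k ∧ p k ≤ S.mask q k / S.power q}

/-- The vector power-control game with gaps `Γ`. -/
def vectorGame (S : LinkSystem Q N) (Γ : Fin Q → ℝ) : StrategicGame (Fin Q) (Fin N → ℝ) where
  strategies := S.allocations
  payoff := fun q p => 1 / N * ∑ k, Real.log (1 + 1 / Γ q * S.sinr p q k)

/-- The channel-diagonalizing precoders `W √(diag (P_q p_q))`. Here `p_q` is normalized by the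
power budget `P_q`, so that `P_q p_q(k)` is the power which user `q` puts on the `k`-th bin. -/
def diagPrecoder (S : LinkSystem Q N) (p : Fin Q → Fin N → ℝ) (q : Fin Q) :
    Matrix (Fin N) (Fin N) ℂ :=
  ifftMatrix N * Matrix.diagonal fun k => (Real.sqrt (S.power q * p q k) : ℂ)

end LinkSystem

end

/-! The IFFT matrix `W` diagonalizes every circulant channel matrix. Hence, when the other users
play diagonal precoders, the gain matrix of user `q` under an arbitrary precoder `Y` is
`1 + Gᴴ D G` with `G = Wᴴ Y` and `D ≥ 0` diagonal, and admissibility of `Y` only depends on the bin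
powers `(G Gᴴ)ₖₖ`. It suffices that no `Y` earns more than the diagonal precoder with the same bin
powers.

For the mutual information this is Hadamard's inequality applied to `1 + D^½ G Gᴴ D^½`, whose
determinant is that of `1 + Gᴴ D G`. For the gap-approximated rate let `M = 1 + Gᴴ D G`. When
`Γ ≥ 1` the rate `log (1 + (1 / x - 1) / Γ)` is convex in the mean square error `x`, and the
diagonal of `M⁻¹` is a doubly stochastic image of its eigenvalues, so the sum of the rates is at
most `log det (1 + (M - 1) / Γ)`, to which Hadamard's inequality applies as before. -/

section Spectral

open Matrix
open scoped ComplexOrder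

variable {m n 𝕜 : Type*} [Fintype m] [Fintype n] [DecidableEq m] [DecidableEq n] [RCLike 𝕜]

lemma sum_map_mulVec_le_of_mem_doublyStochastic {R : Type*} [Field R] [LinearOrder R]
    [IsStrictOrderedRing R] {M : Matrix n n R} (hM : M ∈ doublyStochastic R n) {s : Set R}
    {f : R → R} (hf : ConvexOn R s f) {x : n → R} (hx : ∀ j, x j ∈ s) :
    ∑ i, f ((M *ᵥ x) i) ≤ ∑ j, f (x j) := by
  calc ∑ i, f ((M *ᵥ x) i)
      ≤ ∑ i, ∑ j, M i j * f (x j) := Finset.sum_le_sum fun i _ =>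
        hf.map_sum_le (fun _ _ => nonneg_of_mem_doublyStochastic hM)
          (sum_row_of_mem_doublyStochastic hM i) fun j _ => hx j
    _ = ∑ j, f (x j) := by
        rw [Finset.sum_comm]
        simp only [← Finset.sum_mul, sum_col_of_mem_doublyStochastic hM, one_mul]

lemma norm_sq_mem_doublyStochastic_of_mem_unitaryGroup {U : Matrix n n 𝕜}
    (hU : U ∈ unitaryGroup n 𝕜) : of (fun i j => ‖U i j‖ ^ 2) ∈ doublyStochastic ℝ n := by
  refine mem_doublyStochastic_iff_sum.mpr ⟨fun _ _ => sq_nonneg _, fun i => ?_, fun j => ?_⟩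
  · have h := congr_fun₂ (mem_unitaryGroup_iff.mp hU) i i
    simp only [mul_apply, star_apply, one_apply_eq, RCLike.star_def, RCLike.mul_conj] at h
    exact_mod_cast h
  · have h := congr_fun₂ (mem_unitaryGroup_iff'.mp hU) j j
    simp only [mul_apply, star_apply, one_apply_eq, RCLike.star_def, RCLike.conj_mul] at h
    exact_mod_cast h

lemma re_diag_eq_mulVec_eigenvalues {A : Matrix n n 𝕜} (hA : A.IsHermitian) (k : n) :
    RCLike.re (A k k) =
      (of (fun i j => ‖(hA.eigenvectorUnitary : Matrix n n 𝕜) i j‖ ^ 2) *ᵥ hA.eigenvalues) k := by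
  have h : A k k = ((∑ j, ‖(hA.eigenvectorUnitary : Matrix n n 𝕜) k j‖ ^ 2 *
      hA.eigenvalues j : ℝ) : 𝕜) := by
    conv_lhs => rw [hA.spectral_theorem, Unitary.conjStarAlgAut_apply]
    rw [mul_apply]
    push_cast
    refine Finset.sum_congr rfl fun j _ => ?_
    rw [mul_diagonal, star_apply, RCLike.star_def, ← RCLike.mul_conj, Function.comp_apply]
    ring
  rw [h, RCLike.ofReal_re]
  rfl

lemma sum_map_re_diag_le_sum_map_eigenvalues {A : Matrix n n 𝕜} (hA : A.IsHermitian) {s : Set ℝ}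
    {f : ℝ → ℝ} (hf : ConvexOn ℝ s f) (hs : ∀ j, hA.eigenvalues j ∈ s) :
    ∑ k, f (RCLike.re (A k k)) ≤ ∑ j, f (hA.eigenvalues j) := by
  simp only [re_diag_eq_mulVec_eigenvalues hA]
  exact sum_map_mulVec_le_of_mem_doublyStochastic
    (norm_sq_mem_doublyStochastic_of_mem_unitaryGroup hA.eigenvectorUnitary.2) hf hs

lemma det_smul_one_add_smul_eq_prod_eigenvalues {A : Matrix n n 𝕜} (hA : A.IsHermitian)
    (x y : ℝ) : (x • (1 : Matrix n n 𝕜) + y • A).det =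
      ((∏ j, (x + y * hA.eigenvalues j) : ℝ) : 𝕜) := by
  have h : x • (1 : Matrix n n 𝕜) + y • A =
      Unitary.conjStarAlgAut 𝕜 _ hA.eigenvectorUnitary
        (diagonal fun j => ((x + y * hA.eigenvalues j : ℝ) : 𝕜)) := by
    have hd : (diagonal fun j => ((x + y * hA.eigenvalues j : ℝ) : 𝕜)) =
        (x : 𝕜) • (1 : Matrix n n 𝕜) + (y : 𝕜) • diagonal (RCLike.ofReal ∘ hA.eigenvalues) := by
      rw [smul_one_eq_diagonal, ← diagonal_smul, diagonal_add]
      congr 1 with j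
      simp
    rw [hd, map_add, map_smul, map_smul, map_one, ← hA.spectral_theorem]
    simp only [RCLike.real_smul_eq_coe_smul (K := 𝕜)]
  rw [h, Unitary.conjStarAlgAut_apply, det_mul_right_comm,
    Unitary.mul_star_self_of_mem hA.eigenvectorUnitary.2, one_mul, det_diagonal]
  push_cast
  rfl

/-- Hadamard's inequality, in logarithmic form. -/
lemma log_re_det_le_sum_log_re_diag {A : Matrix n n 𝕜} (hA : A.PosDef) :
    Real.log (RCLike.re A.det) ≤ ∑ k, Real.log (RCLike.re (A k k)) := by
  have h := sum_map_re_diag_le_sum_map_eigenvalues hA.isHermitian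
    strictConcaveOn_log_Ioi.concaveOn.neg hA.eigenvalues_pos
  have hdet : RCLike.re A.det = ∏ j, hA.isHermitian.eigenvalues j := by
    rw [hA.isHermitian.det_eq_prod_eigenvalues, ← RCLike.ofReal_prod, RCLike.ofReal_re]
  rw [hdet, Real.log_prod fun j _ => (hA.eigenvalues_pos j).ne']
  simpa using h

lemma log_re_det_one_add_conjTranspose_mul_diagonal_mul_le (G : Matrix m n 𝕜) {d : m → ℝ}
    (hd : ∀ k, 0 ≤ d k) :
    Real.log (RCLike.re (1 + Gᴴ * diagonal (fun k => (d k : 𝕜)) * G).det) ≤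
      ∑ k, Real.log (1 + d k * RCLike.re ((G * Gᴴ) k k)) := by
  set T : Matrix m m 𝕜 := diagonal fun k => (√(d k) : 𝕜) with hT
  have hTT : diagonal (fun k => (d k : 𝕜)) = T * T := by
    simp only [hT, diagonal_mul_diagonal, ← RCLike.ofReal_mul, Real.mul_self_sqrt (hd _)]
  have hTH : Tᴴ = T := by
    simp [hT, diagonal_conjTranspose, Pi.star_def]
  have hdet : (1 + Gᴴ * diagonal (fun k => (d k : 𝕜)) * G).det =
      (1 + (T * G) * (T * G)ᴴ).det := by
    rw [det_one_add_mul_comm (T * G), conjTranspose_mul, hTH, hTT]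
    simp only [Matrix.mul_assoc]
  have hdiag (k : m) : RCLike.re ((1 + (T * G) * (T * G)ᴴ : Matrix m m 𝕜) k k) =
      1 + d k * RCLike.re ((G * Gᴴ) k k) := by
    have h : (T * G) * (T * G)ᴴ = T * (G * Gᴴ) * T := by
      rw [conjTranspose_mul, hTH]
      simp only [Matrix.mul_assoc]
    rw [h, Matrix.add_apply, one_apply_eq, hT, mul_diagonal, diagonal_mul, mul_right_comm,
      ← RCLike.ofReal_mul, Real.mul_self_sqrt (hd k), map_add, RCLike.one_re, RCLike.re_ofReal_mul]
  rw [hdet]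
  refine (log_re_det_le_sum_log_re_diag
    (PosDef.one.add_posSemidef (posSemidef_self_mul_conjTranspose _))).trans_eq ?_
  simp only [hdiag]

lemma one_add_one_div_sub_one_div_pos {a x : ℝ} (ha : 1 ≤ a) (hx : 0 < x) :
    0 < 1 + (1 / x - 1) / a := by
  have hsplit : 1 + (1 / x - 1) / a = (1 - 1 / a) + 1 / (a * x) := by
    field_simp
    ring
  rw [hsplit]
  have : 1 / a ≤ 1 := (div_le_one (by positivity)).mpr ha
  have : 0 < 1 / (a * x) := by positivity
  linarith

lemma hasDerivAt_log_one_add_one_div_sub_one_div {a x : ℝ} (ha : 1 ≤ a) (hx : 0 < x) :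
    HasDerivAt (fun x => Real.log (1 + (1 / x - 1) / a)) (-(1 / (x * ((a - 1) * x + 1)))) x := by
  have hpos := one_add_one_div_sub_one_div_pos ha hx
  have : 0 < (a - 1) * x + 1 := by nlinarith
  have hval : 1 + (1 / x - 1) / a = ((a - 1) * x + 1) / (a * x) := by
    field_simp
    ring
  have h := ((((hasDerivAt_inv hx.ne').sub_const 1).div_const a).const_add 1).log
    (by simpa only [one_div] using hpos.ne')
  simp only [← one_div] at h
  refine h.congr_deriv ?_
  rw [hval]
  field_simp

lemma convexOn_log_one_add_one_div_sub_one_div {a : ℝ} (ha : 1 ≤ a) :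
    ConvexOn ℝ (Set.Ioi 0) fun x => Real.log (1 + (1 / x - 1) / a) := by
  have hderiv (x : ℝ) (hx : x ∈ Set.Ioi 0) := hasDerivAt_log_one_add_one_div_sub_one_div ha hx
  refine MonotoneOn.convexOn_of_deriv (convex_Ioi 0)
    (fun x hx => (hderiv x hx).continuousAt.continuousWithinAt) ?_ ?_ <;> rw [interior_Ioi]
  · exact fun x hx => (hderiv x hx).differentiableAt.differentiableWithinAt
  · intro x (hx : 0 < x) y (hy : 0 < y) hxy
    rw [(hderiv x hx).deriv, (hderiv y hy).deriv]
    have : 0 ≤ a - 1 := sub_nonneg.mpr ha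
    gcongr

lemma sum_log_gap_le_log_re_det {M : Matrix n n 𝕜} (hM : M.PosDef) {a : ℝ} (ha : 1 ≤ a) :
    ∑ k, Real.log (1 + (1 / RCLike.re (M⁻¹ k k) - 1) / a) ≤
      Real.log (RCLike.re (1 + (1 / a) • (M - 1)).det) := by
  have hE : M⁻¹.PosDef := hM.inv
  set e := hE.isHermitian.eigenvalues
  have he0 (j : n) : 0 < e j := hE.eigenvalues_pos j
  have hunit : IsUnit M.det := (isUnit_iff_isUnit_det M).mp hM.isUnit
  have hdet : (1 + (1 / a) • (M - 1)).det = ((∏ j, (1 + (1 / e j - 1) / a) : ℝ) : 𝕜) := by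
    have hfactor : 1 + (1 / a) • (M - 1) = M * ((1 / a) • 1 + (1 - 1 / a) • M⁻¹) := by
      rw [mul_add, Matrix.mul_smul, Matrix.mul_smul, mul_one,
        mul_nonsing_inv _ hunit]
      module
    have hdetM : M.det = ((∏ j, (e j)⁻¹ : ℝ) : 𝕜) := by
      rw [Finset.prod_inv_distrib, RCLike.ofReal_inv, RCLike.ofReal_prod,
        ← hE.isHermitian.det_eq_prod_eigenvalues]
      exact eq_inv_of_mul_eq_one_right (det_nonsing_inv_mul_det M hunit)
    rw [hfactor, det_mul, det_smul_one_add_smul_eq_prod_eigenvalues hE.isHermitian, hdetM,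
      ← RCLike.ofReal_mul, ← Finset.prod_mul_distrib]
    congr 2 with j
    have := (he0 j).ne'
    field_simp
    ring
  rw [hdet, RCLike.ofReal_re,
    Real.log_prod fun j _ => (one_add_one_div_sub_one_div_pos ha (he0 j)).ne']
  exact sum_map_re_diag_le_sum_map_eigenvalues hE.isHermitian
    (convexOn_log_one_add_one_div_sub_one_div ha) he0

lemma sum_log_gap_one_add_conjTranspose_mul_diagonal_mul_le (G : Matrix m n 𝕜) {d : m → ℝ}
    (hd : ∀ k, 0 ≤ d k) {a : ℝ} (ha : 1 ≤ a) :
    ∑ k, Real.log (1 + (1 / RCLike.re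
        ((1 + Gᴴ * diagonal (fun k => (d k : 𝕜)) * G : Matrix n n 𝕜)⁻¹ k k) - 1) / a) ≤
      ∑ k, Real.log (1 + d k * RCLike.re ((G * Gᴴ) k k) / a) := by
  have hM : (1 + Gᴴ * diagonal (fun k => (d k : 𝕜)) * G).PosDef :=
    PosDef.one.add_posSemidef ((PosSemidef.diagonal fun k =>
      RCLike.ofReal_nonneg.mpr (hd k)).conjTranspose_mul_mul_same G)
  have hscale : (1 / a) • (Gᴴ * diagonal (fun k => (d k : 𝕜)) * G) =
      Gᴴ * diagonal (fun k => ((d k / a : ℝ) : 𝕜)) * G := by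
    rw [← Matrix.smul_mul, ← Matrix.mul_smul, ← diagonal_smul]
    congr 3 with k
    rw [Pi.smul_apply, RCLike.real_smul_eq_coe_mul, ← RCLike.ofReal_mul, one_div_mul_eq_div]
  refine (sum_log_gap_le_log_re_det hM ha).trans ?_
  simp only [add_sub_cancel_left, hscale, mul_div_right_comm]
  exact log_re_det_one_add_conjTranspose_mul_diagonal_mul_le G
    fun k => div_nonneg (hd k) (by positivity)

end Spectral

namespace StrategicGame

open Function

variable {ι A B : Type} [DecidableEq ι]

/-- `G` reduces to `H` when every strategy `b ∈ D` of player `q` in `H` has a lift to `G` and every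
strategy of `q` in `G` has a projection to `H`, such that payoffs at lifted profiles are those of
`H` in the unit `u`, and a unilateral deviation from a lifted profile earns at most what its
projection earns in `H`. -/
structure ReducesTo (G : StrategicGame ι A) (H : StrategicGame ι B) (D : Set B)
    (lift : ι → B → A) (proj : ι → A → B) (u : ℝ → ℝ) : Prop where
  strictMono : StrictMono u
  strategies_subset (q : ι) : H.strategies q ⊆ D
  lift_mem_iff {q : ι} {b : B} (hb : b ∈ D) : lift q b ∈ G.strategies q ↔ b ∈ H.strategies q
  proj_mem {q : ι} {a : A} (ha : a ∈ G.strategies q) : proj q a ∈ H.strategies q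
  payoff_lift {x : ι → B} (hx : ∀ r, x r ∈ D) (q : ι) :
    G.payoff q (fun r => lift r (x r)) = u (H.payoff q x)
  payoff_update_lift_le {x : ι → B} (hx : ∀ r, x r ∈ D) (q : ι) (a : A) :
    G.payoff q (update (fun r => lift r (x r)) q a) ≤ u (H.payoff q (update x q (proj q a)))

namespace ReducesTo

variable {G : StrategicGame ι A} {H : StrategicGame ι B} {D : Set B} {lift : ι → B → A}
  {proj : ι → A → B} {u : ℝ → ℝ} {x : ι → B}

lemma update_mem (h : G.ReducesTo H D lift proj u) (hx : ∀ r, x r ∈ D) {q : ι} {b : B}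
    (hb : b ∈ H.strategies q) (r : ι) : update x q b r ∈ D :=
  forall_update_iff x (fun _ c => c ∈ D) |>.mpr
    ⟨h.strategies_subset q hb, fun r _ => hx r⟩ r

lemma isBestResponse_iff (h : G.ReducesTo H D lift proj u) (hx : ∀ r, x r ∈ D) (q : ι) :
    G.IsBestResponse (fun r => lift r (x r)) q ↔ H.IsBestResponse x q := by
  refine and_congr (h.lift_mem_iff (hx q)) ⟨fun hbest b hb => ?_, fun hbest a ha => ?_⟩
  · have hxb := h.update_mem hx hb
    have hle := hbest (lift q b) ((h.lift_mem_iff (h.strategies_subset q hb)).mpr hb)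
    have hupd : update (fun r => lift r (x r)) q (lift q b) = fun r => lift r (update x q b r) :=
      funext fun r => (apply_update lift x q b r).symm
    rwa [hupd, h.payoff_lift hxb, h.payoff_lift hx, h.strictMono.le_iff_le] at hle
  · calc G.payoff q (update (fun r => lift r (x r)) q a)
        ≤ u (H.payoff q (update x q (proj q a))) := h.payoff_update_lift_le hx q a
      _ ≤ u (H.payoff q x) := h.strictMono.monotone (hbest _ (h.proj_mem ha))
      _ = G.payoff q (fun r => lift r (x r)) := (h.payoff_lift hx q).symm

lemma isNash_iff (h : G.ReducesTo H D lift proj u) (hx : ∀ r, x r ∈ D) :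
    G.IsNash (fun r => lift r (x r)) ↔ H.IsNash x :=
  forall_congr' (h.isBestResponse_iff hx)

lemma isBestResponse_lift_update (h : G.ReducesTo H D lift proj u) (hx : ∀ r, x r ∈ D) {q : ι}
    {b : B} (hb : H.IsBestResponse (update x q b) q) :
    G.IsBestResponse (fun r => lift r (update x q b r)) q :=
  (h.isBestResponse_iff (h.update_mem hx (by simpa using hb.1)) q).mpr hb

end ReducesTo

end StrategicGame

section Fourier

open Matrix

variable {N : ℕ} [NeZero N]

lemma bijective_fin_cast_zmod : Function.Bijective fun a : Fin N => ((a : ℕ) : ZMod N) := by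
  refine (Fintype.bijective_iff_injective_and_card _).mpr ⟨fun a b hab => ?_, by simp⟩
  have h := (ZMod.natCast_eq_natCast_iff' (a : ℕ) b N).mp hab
  rw [Nat.mod_eq_of_lt a.2, Nat.mod_eq_of_lt b.2] at h
  exact Fin.ext h

lemma ifftMatrix_apply (a b : Fin N) :
    ifftMatrix N a b = ZMod.stdAddChar ((a : ℕ) * (b : ℕ) : ZMod N) / (√N : ℂ) := by
  have h := ZMod.stdAddChar_coe (N := N) ((a : ℕ) * (b : ℕ) : ℤ)
  push_cast at h
  rw [h, ifftMatrix, of_apply]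
  congr 2
  ring

lemma ifftMatrix_mem_unitaryGroup : ifftMatrix N ∈ unitaryGroup (Fin N) ℂ := by
  rw [mem_unitaryGroup_iff']
  ext b c
  have hsq : (√N : ℂ) * (√N : ℂ) = N := by
    rw [← Complex.ofReal_mul, Real.mul_self_sqrt (Nat.cast_nonneg N), Complex.ofReal_natCast]
  have hterm (a : Fin N) : star (ifftMatrix N a b) * ifftMatrix N a c =
      ZMod.stdAddChar ((a : ℕ) * ((c : ℕ) - (b : ℕ)) : ZMod N) / N := by
    rw [ifftMatrix_apply, ifftMatrix_apply, RCLike.star_def, map_div₀, Complex.conj_ofReal,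
      ← AddChar.map_neg_eq_conj, div_mul_div_comm, hsq, ← AddChar.map_add_eq_mul]
    congr 2
    ring
  have hsum := (bijective_fin_cast_zmod (N := N)).sum_comp fun a : ZMod N =>
    ZMod.stdAddChar (a * (((c : ℕ) : ZMod N) - ((b : ℕ) : ZMod N)))
  simp only [AddChar.sum_mulShift _ (ZMod.isPrimitive_stdAddChar N), sub_eq_zero,
    bijective_fin_cast_zmod.injective.eq_iff, ZMod.card] at hsum
  simp only [mul_apply, star_apply, hterm, ← Finset.sum_div, hsum, one_apply, eq_comm (a := b)]
  split_ifs <;> simp [NeZero.ne N]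

variable (N) in
/-- The circulant matrix `W diag(d) Wᴴ` which multiplies the `k`-th discrete Fourier coefficient by
`d k`, as a star algebra homomorphism in `d`. -/
noncomputable def fourierMultiplier : (Fin N → ℂ) →⋆ₐ[ℂ] Matrix (Fin N) (Fin N) ℂ :=
  (Unitary.conjStarAlgAut ℂ _ ⟨ifftMatrix N, ifftMatrix_mem_unitaryGroup⟩ :
    Matrix (Fin N) (Fin N) ℂ →⋆ₐ[ℂ] Matrix (Fin N) (Fin N) ℂ).comp
    { diagonalAlgHom ℂ with map_star' := fun d => (diagonal_conjTranspose d).symm }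

lemma fourierMultiplier_apply (d : Fin N → ℂ) :
    fourierMultiplier N d = ifftMatrix N * diagonal d * (ifftMatrix N)ᴴ :=
  rfl

lemma inv_fourierMultiplier {d : Fin N → ℂ} (hd : ∀ k, d k ≠ 0) :
    (fourierMultiplier N d)⁻¹ = fourierMultiplier N d⁻¹ := by
  refine inv_eq_right_inv ?_
  rw [← map_mul, ← map_one (fourierMultiplier N)]
  exact congrArg _ (funext fun k => mul_inv_cancel₀ (hd k))

lemma sum_ite_modEq_mul_ifftMatrix (c : ℂ) (l : ℕ) (i k : Fin N) :
    ∑ j : Fin N, (if (j : ℕ) + l ≡ i [MOD N] then c else 0) * ifftMatrix N j k =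
      c * ZMod.stdAddChar (-(l * (k : ℕ)) : ZMod N) * ifftMatrix N i k := by
  obtain ⟨j, hj : ((j : ℕ) : ZMod N) = (i : ℕ) - l⟩ :=
    (bijective_fin_cast_zmod (N := N)).surjective ((i : ℕ) - l)
  have hiff (b : Fin N) : (b : ℕ) + l ≡ i [MOD N] ↔ b = j := by
    rw [← ZMod.natCast_eq_natCast_iff, ← bijective_fin_cast_zmod.injective.eq_iff (a := b), hj,
      eq_sub_iff_add_eq, Nat.cast_add]
  simp only [hiff, ite_mul, zero_mul, Finset.sum_ite_eq', Finset.mem_univ, if_true]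
  have hshift : (ZMod.stdAddChar (((i : ℕ) - l) * (k : ℕ) : ZMod N) : ℂ) =
      ZMod.stdAddChar (-(l * (k : ℕ)) : ZMod N) * ZMod.stdAddChar ((i : ℕ) * (k : ℕ) : ZMod N) := by
    rw [← AddChar.map_add_eq_mul]
    congr 1
    ring
  rw [ifftMatrix_apply, ifftMatrix_apply, hj, hshift]
  ring

end Fourier

namespace LinkSystem

open Function Matrix

variable {Q N : ℕ} {S : LinkSystem Q N} {p : Fin Q → Fin N → ℝ} {Γ : Fin Q → ℝ}

lemma pathLoss_pos (S : LinkSystem Q N) (r q : Fin Q) : 0 < S.pathLoss r q :=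
  Real.rpow_pos_of_pos (S.dist_pos r q) _

/-- Interference-plus-noise power on bin `k` at destination `q`, i.e. the denominator of
`sinr`. -/
noncomputable def interfPower (S : LinkSystem Q N) (p : Fin Q → Fin N → ℝ) (q : Fin Q)
    (k : Fin N) : ℝ :=
  S.noise q ^ 2 + ∑ r ∈ Finset.univ.erase q,
    S.power r * ‖S.freqResp r q k‖ ^ 2 * p r k / S.pathLoss r q

/-- SINR of user `q` on bin `k` per unit of transmit power. -/
noncomputable def chanGain (S : LinkSystem Q N) (p : Fin Q → Fin N → ℝ) (q : Fin Q)
    (k : Fin N) : ℝ :=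
  ‖S.freqResp q q k‖ ^ 2 / S.pathLoss q q / S.interfPower p q k

lemma interfPower_pos (hp : ∀ r k, 0 ≤ p r k) (q : Fin Q) (k : Fin N) :
    0 < S.interfPower p q k := by
  refine add_pos_of_pos_of_nonneg (pow_pos (S.noise_pos q) 2) (Finset.sum_nonneg fun r _ => ?_)
  have := hp r k
  have := S.pathLoss_pos r q
  have := S.power_pos r
  positivity

lemma chanGain_nonneg (hp : ∀ r k, 0 ≤ p r k) (q : Fin Q) (k : Fin N) : 0 ≤ S.chanGain p q k :=
  div_nonneg (div_nonneg (sq_nonneg _) (S.pathLoss_pos q q).le) (interfPower_pos hp q k).le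

lemma interfPower_update_self (q : Fin Q) (y : Fin N → ℝ) :
    S.interfPower (update p q y) q = S.interfPower p q := by
  ext k
  refine congrArg _ (Finset.sum_congr rfl fun r hr => ?_)
  rw [update_of_ne (Finset.ne_of_mem_erase hr)]

lemma sinr_eq_chanGain_mul (q : Fin Q) (k : Fin N) :
    S.sinr p q k = S.chanGain p q k * (S.power q * p q k) := by
  rw [sinr, chanGain, interfPower]
  ring

lemma sinr_update_self (q : Fin Q) (y : Fin N → ℝ) (k : Fin N) :
    S.sinr (update p q y) q k = S.chanGain p q k * (S.power q * y k) := by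
  rw [sinr_eq_chanGain_mul, update_self, chanGain, interfPower_update_self, chanGain]

lemma one_add_sinr_pos (hp : ∀ r k, 0 ≤ p r k) (q : Fin Q) (k : Fin N) :
    0 < 1 + S.sinr p q k := by
  have := chanGain_nonneg (S := S) hp q k
  have := S.power_pos q
  have := hp q k
  rw [sinr_eq_chanGain_mul]
  positivity

lemma sinr_eq_normResp (p : Fin Q → Fin N → ℝ) (q : Fin Q) (k : Fin N) :
    S.sinr p q k = ‖S.normResp q q k‖ ^ 2 * p q k /
      (1 + ∑ r ∈ Finset.univ.erase q, ‖S.normResp r q k‖ ^ 2 * p r k) := by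
  have hσ : S.noise q ^ 2 ≠ 0 := (pow_pos (S.noise_pos q) 2).ne'
  have hterm (r : Fin Q) : ‖S.normResp r q k‖ ^ 2 * p r k =
      S.power r * ‖S.freqResp r q k‖ ^ 2 * p r k / S.pathLoss r q / S.noise q ^ 2 := by
    have := S.power_pos r
    have := S.pathLoss_pos r q
    rw [normResp, norm_mul, mul_pow, Complex.norm_real, Real.norm_eq_abs, sq_abs,
      Real.sq_sqrt (by positivity)]
    field_simp
  simp only [hterm]
  rw [← Finset.sum_div, sinr, ← div_self hσ, ← add_div, div_div_div_cancel_right₀ hσ]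

/-- Eigenvalue of the circulant matrix `channel r q` for the `k`-th Fourier mode. -/
noncomputable def channelEigenvalue (S : LinkSystem Q N) (r q : Fin Q) (k : Fin N) : ℂ :=
  S.freqResp r q k / (√(S.pathLoss r q) : ℂ)

lemma channelEigenvalue_mul_star (r q : Fin Q) (k : Fin N) :
    S.channelEigenvalue r q k * star (S.channelEigenvalue r q k) =
      ((‖S.freqResp r q k‖ ^ 2 / S.pathLoss r q : ℝ) : ℂ) := by
  rw [RCLike.star_def, Complex.mul_conj, Complex.normSq_eq_norm_sq, channelEigenvalue, norm_div,
    div_pow, Complex.norm_real, Real.norm_eq_abs, sq_abs, Real.sq_sqrt (S.pathLoss_pos r q).le]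

lemma interfCov_update_self (F : Fin Q → Matrix (Fin N) (Fin N) ℂ) (q : Fin Q)
    (Y : Matrix (Fin N) (Fin N) ℂ) : S.interfCov (update F q Y) q = S.interfCov F q := by
  rw [interfCov, interfCov]
  congr 1
  refine Finset.sum_congr rfl fun r hr => ?_
  rw [update_of_ne (Finset.ne_of_mem_erase hr)]

section FrequencyDomain

variable [NeZero N]

lemma channel_mul_ifftMatrix (S : LinkSystem Q N) (r q : Fin Q) :
    S.channel r q * ifftMatrix N = ifftMatrix N * diagonal (S.channelEigenvalue r q) := by
  have hexp (l : ℕ) (k : Fin N) : ZMod.stdAddChar (-(l * (k : ℕ)) : ZMod N) =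
      Complex.exp (-(2 * Real.pi * Complex.I * l * (k : ℕ) / N)) := by
    have h := ZMod.stdAddChar_coe (N := N) (-(l * (k : ℕ)) : ℤ)
    push_cast at h
    rw [h]
    congr 1
    ring
  ext i k
  rw [mul_diagonal, mul_apply]
  simp only [channel, of_apply, Finset.sum_mul]
  rw [Finset.sum_comm]
  simp only [sum_ite_modEq_mul_ifftMatrix, hexp, channelEigenvalue, freqResp, ← Finset.sum_mul,
    div_mul_eq_mul_div, ← Finset.sum_div]
  ring

lemma channel_eq_fourierMultiplier (S : LinkSystem Q N) (r q : Fin Q) :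
    S.channel r q = fourierMultiplier N (S.channelEigenvalue r q) := by
  rw [fourierMultiplier_apply, ← channel_mul_ifftMatrix, Matrix.mul_assoc, ← star_eq_conjTranspose,
    mem_unitaryGroup_iff.mp ifftMatrix_mem_unitaryGroup, Matrix.mul_one]

lemma diagPrecoder_mul_conjTranspose (hp : ∀ r k, 0 ≤ p r k) (r : Fin Q) :
    S.diagPrecoder p r * (S.diagPrecoder p r)ᴴ =
      fourierMultiplier N fun k => ((S.power r * p r k : ℝ) : ℂ) := by
  have hsq (k : Fin N) : (√(S.power r * p r k) : ℂ) * star (√(S.power r * p r k) : ℂ) =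
      ((S.power r * p r k : ℝ) : ℂ) := by
    rw [RCLike.star_def, Complex.conj_ofReal, ← Complex.ofReal_mul,
      Real.mul_self_sqrt (mul_nonneg (S.power_pos r).le (hp r k))]
  rw [fourierMultiplier_apply, diagPrecoder, conjTranspose_mul, diagonal_conjTranspose,
    Matrix.mul_assoc, ← Matrix.mul_assoc (diagonal _) (diagonal _), diagonal_mul_diagonal,
    ← Matrix.mul_assoc]
  simp only [Pi.star_apply, hsq]

lemma interfCov_diagPrecoder (hp : ∀ r k, 0 ≤ p r k) (q : Fin Q) :
    S.interfCov (S.diagPrecoder p) q =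
      fourierMultiplier N fun k => (S.interfPower p q k : ℂ) := by
  have hterm (r : Fin Q) : S.channel r q * S.diagPrecoder p r * (S.diagPrecoder p r)ᴴ *
      (S.channel r q)ᴴ = fourierMultiplier N fun k =>
        ((S.power r * ‖S.freqResp r q k‖ ^ 2 * p r k / S.pathLoss r q : ℝ) : ℂ) := by
    rw [Matrix.mul_assoc (S.channel r q), diagPrecoder_mul_conjTranspose hp,
      channel_eq_fourierMultiplier, ← star_eq_conjTranspose, ← map_star, ← map_mul, ← map_mul]
    congr 1 with k
    rw [Pi.mul_apply, Pi.mul_apply, Pi.star_apply, mul_right_comm, channelEigenvalue_mul_star,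
      ← Complex.ofReal_mul]
    congr 1
    ring
  simp only [interfCov, hterm]
  rw [← map_one (fourierMultiplier N), ← map_smul, ← map_sum, ← map_add]
  refine congrArg _ (funext fun k => ?_)
  simp [interfPower]

lemma gainMatrix_update_diagPrecoder (hp : ∀ r k, 0 ≤ p r k) (q : Fin Q)
    (Y : Matrix (Fin N) (Fin N) ℂ) :
    S.gainMatrix (update (S.diagPrecoder p) q Y) q = 1 + ((ifftMatrix N)ᴴ * Y)ᴴ *
      diagonal (fun k => (S.chanGain p q k : ℂ)) * ((ifftMatrix N)ᴴ * Y) := by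
  have hne (k : Fin N) : (S.interfPower p q k : ℂ) ≠ 0 :=
    Complex.ofReal_ne_zero.mpr (interfPower_pos hp q k).ne'
  have hmult : (S.channel q q)ᴴ * (S.interfCov (S.diagPrecoder p) q)⁻¹ * S.channel q q =
      fourierMultiplier N fun k => (S.chanGain p q k : ℂ) := by
    rw [interfCov_diagPrecoder hp, inv_fourierMultiplier hne, channel_eq_fourierMultiplier,
      ← star_eq_conjTranspose, ← map_star, ← map_mul, ← map_mul]
    congr 1 with k
    rw [Pi.mul_apply, Pi.mul_apply, Pi.star_apply, Pi.inv_apply, mul_comm, ← mul_assoc,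
      channelEigenvalue_mul_star, chanGain, ← div_eq_mul_inv, ← Complex.ofReal_div]
  rw [gainMatrix, update_self, interfCov_update_self, Matrix.mul_assoc Yᴴ, Matrix.mul_assoc Yᴴ,
    hmult, fourierMultiplier_apply, conjTranspose_mul, conjTranspose_conjTranspose]
  simp only [Matrix.mul_assoc]

lemma conjTranspose_ifftMatrix_mul_diagPrecoder (p : Fin Q → Fin N → ℝ) (q : Fin Q) :
    (ifftMatrix N)ᴴ * S.diagPrecoder p q = diagonal fun k => (√(S.power q * p q k) : ℂ) := by
  rw [diagPrecoder, ← Matrix.mul_assoc, ← star_eq_conjTranspose,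
    mem_unitaryGroup_iff'.mp ifftMatrix_mem_unitaryGroup, Matrix.one_mul]

lemma gainMatrix_diagPrecoder (hp : ∀ r k, 0 ≤ p r k) (q : Fin Q) :
    S.gainMatrix (S.diagPrecoder p) q = diagonal fun k => ((1 + S.sinr p q k : ℝ) : ℂ) := by
  have h := gainMatrix_update_diagPrecoder (S := S) hp q (S.diagPrecoder p q)
  rw [update_eq_self, conjTranspose_ifftMatrix_mul_diagPrecoder, diagonal_conjTranspose,
    diagonal_mul_diagonal, diagonal_mul_diagonal, ← diagonal_one, diagonal_add] at h
  rw [h]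
  congr 1 with k
  rw [sinr_eq_chanGain_mul, Pi.star_apply, RCLike.star_def, Complex.conj_ofReal, mul_right_comm,
    ← Complex.ofReal_mul, Real.mul_self_sqrt (mul_nonneg (S.power_pos q).le (hp q k))]
  push_cast
  ring

end FrequencyDomain

/-- Power that the precoder `F` of user `q` puts on bin `k`, normalized by the power budget: the
projection from precoders to power allocations that is left inverse to `diagPrecoder`. -/
noncomputable def binPower (S : LinkSystem Q N) (q : Fin Q) (F : Matrix (Fin N) (Fin N) ℂ)
    (k : Fin N) : ℝ :=
  ((((ifftMatrix N)ᴴ * F) * ((ifftMatrix N)ᴴ * F)ᴴ) k k).re / S.power q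

lemma power_mul_binPower (q : Fin Q) (F : Matrix (Fin N) (Fin N) ℂ) (k : Fin N) :
    S.power q * S.binPower q F k = ((((ifftMatrix N)ᴴ * F) * ((ifftMatrix N)ᴴ * F)ᴴ) k k).re :=
  mul_div_cancel₀ _ (S.power_pos q).ne'

open scoped ComplexOrder in
lemma binPower_nonneg (q : Fin Q) (F : Matrix (Fin N) (Fin N) ℂ) (k : Fin N) :
    0 ≤ S.binPower q F k :=
  div_nonneg (Complex.nonneg_iff.mp
    (posSemidef_self_mul_conjTranspose ((ifftMatrix N)ᴴ * F)).diag_nonneg).1 (S.power_pos q).le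

lemma power_mul_sum_binPower [NeZero N] (q : Fin Q) (F : Matrix (Fin N) (Fin N) ℂ) :
    S.power q * ∑ k, S.binPower q F k = (F * Fᴴ).trace.re := by
  have htrace : (((ifftMatrix N)ᴴ * F) * ((ifftMatrix N)ᴴ * F)ᴴ).trace = (F * Fᴴ).trace := by
    rw [trace_mul_comm, conjTranspose_mul, conjTranspose_conjTranspose, Matrix.mul_assoc,
      ← Matrix.mul_assoc (ifftMatrix N), ← star_eq_conjTranspose (ifftMatrix N),
      mem_unitaryGroup_iff.mp ifftMatrix_mem_unitaryGroup, Matrix.one_mul, trace_mul_comm]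
  rw [← htrace, Finset.mul_sum, trace, Complex.re_sum]
  exact Finset.sum_congr rfl fun k _ => power_mul_binPower q F k

lemma mem_precoders_iff [NeZero N] (q : Fin Q) (F : Matrix (Fin N) (Fin N) ℂ) :
    F ∈ S.precoders q ↔ S.binPower q F ∈ S.allocations q := by
  have hmask (k : Fin N) : (((ifftMatrix N)ᴴ * F * Fᴴ * ifftMatrix N) k k).re =
      S.power q * S.binPower q F k := by
    rw [power_mul_binPower, conjTranspose_mul, conjTranspose_conjTranspose]
    simp only [Matrix.mul_assoc]
  simp only [precoders, allocations, Set.mem_ofPred_eq, ← power_mul_sum_binPower (S := S) q, hmask,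
    binPower_nonneg, true_and, le_div_iff₀' (S.power_pos q),
    mul_left_comm _ (S.power q), mul_le_iff_le_one_right (S.power_pos q)]

lemma binPower_diagPrecoder [NeZero N] {q : Fin Q} (hp : ∀ k, 0 ≤ p q k) :
    S.binPower q (S.diagPrecoder p q) = p q := by
  ext k
  refine mul_left_cancel₀ (S.power_pos q).ne' ?_
  rw [power_mul_binPower, conjTranspose_ifftMatrix_mul_diagPrecoder, diagonal_conjTranspose,
    diagonal_mul_diagonal, diagonal_apply_eq, Pi.star_apply, RCLike.star_def,
    Complex.conj_ofReal, ← Complex.ofReal_mul,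
    Real.mul_self_sqrt (mul_nonneg (S.power_pos q).le (hp k)), Complex.ofReal_re]

lemma diagPrecoder_mem_precoders_iff [NeZero N] {q : Fin Q} (hp : ∀ k, 0 ≤ p q k) :
    S.diagPrecoder p q ∈ S.precoders q ↔ p q ∈ S.allocations q := by
  rw [mem_precoders_iff, binPower_diagPrecoder hp]

lemma isCompact_allocations (S : LinkSystem Q N) (q : Fin Q) : IsCompact (S.allocations q) := by
  have hinter : S.allocations q = Set.Icc 0 (fun k => S.mask q k / S.power q) ∩
      {y | 1 / N * ∑ k, y k ≤ 1} := by
    ext y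
    simp only [allocations, Set.mem_inter_iff, Set.mem_Icc, Pi.le_def, Set.mem_ofPred_eq,
      forall_and, and_comm, Pi.zero_apply]
  rw [hinter]
  exact isCompact_Icc.inter_right (isClosed_le (by fun_prop) continuous_const)

lemma zero_mem_allocations (S : LinkSystem Q N) (q : Fin Q) : 0 ∈ S.allocations q :=
  ⟨by simp, fun k => ⟨le_rfl, div_nonneg (S.mask_nonneg q k) (S.power_pos q).le⟩⟩

lemma exists_isBestResponse_vectorGame {q : Fin Q} (hΓ : 0 < Γ q) (hp : ∀ r k, 0 ≤ p r k) :
    ∃ y, (S.vectorGame Γ).IsBestResponse (update p q y) q := by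
  have hcont : ContinuousOn (fun y => (S.vectorGame Γ).payoff q (update p q y))
      (S.allocations q) := by
    simp only [vectorGame, sinr_update_self]
    refine continuousOn_const.mul (continuousOn_finsetSum _ fun k _ => ?_)
    refine ContinuousOn.log (by fun_prop) fun y hy => ?_
    have := chanGain_nonneg (S := S) hp q k
    have := S.power_pos q
    have := (hy.2 k).1
    positivity
  obtain ⟨y, hy, hmax⟩ :=
    (S.isCompact_allocations q).exists_isMaxOn ⟨0, S.zero_mem_allocations q⟩ hcont
  refine ⟨y, by simpa [vectorGame] using hy, fun z hz => ?_⟩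
  rw [update_idem]
  exact hmax hz

section Payoffs

variable [NeZero N]

lemma mutualInfo_diagPrecoder (hp : ∀ r k, 0 ≤ p r k) (q : Fin Q) :
    S.mutualInfo (S.diagPrecoder p) q = 1 / N * ∑ k, Real.log (1 + S.sinr p q k) := by
  rw [mutualInfo, gainMatrix_diagPrecoder hp, det_diagonal, ← Complex.ofReal_prod,
    Complex.ofReal_re, Real.log_prod fun k _ => (one_add_sinr_pos hp q k).ne']

lemma mmseSINR_diagPrecoder (hp : ∀ r k, 0 ≤ p r k) (q : Fin Q) (k : Fin N) :
    S.mmseSINR (S.diagPrecoder p) q k = S.sinr p q k := by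
  have hinv : (S.gainMatrix (S.diagPrecoder p) q)⁻¹ =
      diagonal fun k => (((1 + S.sinr p q k)⁻¹ : ℝ) : ℂ) := by
    refine inv_eq_right_inv ?_
    rw [gainMatrix_diagPrecoder hp, diagonal_mul_diagonal, ← diagonal_one]
    congr 1 with k
    rw [← Complex.ofReal_mul, mul_inv_cancel₀ (one_add_sinr_pos hp q k).ne', Complex.ofReal_one]
  rw [mmseSINR, hinv, diagonal_apply_eq, Complex.ofReal_re, one_div, inv_inv, add_sub_cancel_left]

lemma game1_payoff_diagPrecoder (hp : ∀ r k, 0 ≤ p r k) (q : Fin Q) :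
    S.game1.payoff q (S.diagPrecoder p) = (S.vectorGame 1).payoff q p := by
  simp only [game1, vectorGame, mutualInfo_diagPrecoder hp, Pi.one_apply, div_one, one_mul]

lemma game2_payoff_diagPrecoder (Γ : Fin Q → ℝ) (hp : ∀ r k, 0 ≤ p r k) (q : Fin Q) :
    (S.game2 Γ).payoff q (S.diagPrecoder p) = (S.vectorGame Γ).payoff q p / Real.log 2 := by
  simp only [game2, vectorGame, gapRate, mmseSINR_diagPrecoder hp, Real.logb, ← Finset.sum_div,
    mul_div_assoc, one_div_mul_eq_div (Γ q)]

lemma game1_payoff_update_le (hp : ∀ r k, 0 ≤ p r k) (q : Fin Q)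
    (Y : Matrix (Fin N) (Fin N) ℂ) :
    S.game1.payoff q (update (S.diagPrecoder p) q Y) ≤
      (S.vectorGame 1).payoff q (update p q (S.binPower q Y)) := by
  simp only [game1, vectorGame, mutualInfo, gainMatrix_update_diagPrecoder hp, sinr_update_self,
    power_mul_binPower, Pi.one_apply, div_one, one_mul]
  refine mul_le_mul_of_nonneg_left ?_ (by positivity)
  exact log_re_det_one_add_conjTranspose_mul_diagonal_mul_le ((ifftMatrix N)ᴴ * Y)
    (chanGain_nonneg hp q)

lemma game2_payoff_update_le {q : Fin Q} (hΓ : 1 ≤ Γ q) (hp : ∀ r k, 0 ≤ p r k)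
    (Y : Matrix (Fin N) (Fin N) ℂ) :
    (S.game2 Γ).payoff q (update (S.diagPrecoder p) q Y) ≤
      (S.vectorGame Γ).payoff q (update p q (S.binPower q Y)) / Real.log 2 := by
  simp only [game2, vectorGame, gapRate, mmseSINR, gainMatrix_update_diagPrecoder hp,
    sinr_update_self, power_mul_binPower, Real.logb, ← Finset.sum_div, mul_div_assoc (1 / (N : ℝ)),
    one_div_mul_eq_div (Γ q)]
  refine mul_le_mul_of_nonneg_left (div_le_div_of_nonneg_right ?_ (Real.log_nonneg one_le_two))
    (by positivity)
  exact sum_log_gap_one_add_conjTranspose_mul_diagonal_mul_le ((ifftMatrix N)ᴴ * Y)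
    (chanGain_nonneg hp q) hΓ

lemma game1_reducesTo_vectorGame (S : LinkSystem Q N) :
    S.game1.ReducesTo (S.vectorGame 1) (Set.Ici 0) (fun q y => S.diagPrecoder (fun _ => y) q)
      S.binPower id where
  strictMono := strictMono_id
  strategies_subset _ _ hy k := (hy.2 k).1
  lift_mem_iff hy := diagPrecoder_mem_precoders_iff hy
  proj_mem := (mem_precoders_iff _ _).mp
  payoff_lift := game1_payoff_diagPrecoder
  payoff_update_lift_le := game1_payoff_update_le

lemma game2_reducesTo_vectorGame (S : LinkSystem Q N) (hΓ : ∀ q, 1 ≤ Γ q) :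
    (S.game2 Γ).ReducesTo (S.vectorGame Γ) (Set.Ici 0)
      (fun q y => S.diagPrecoder (fun _ => y) q) S.binPower (· / Real.log 2) where
  strictMono _ _ h := div_lt_div_of_pos_right h (Real.log_pos one_lt_two)
  strategies_subset _ _ hy k := (hy.2 k).1
  lift_mem_iff hy := diagPrecoder_mem_precoders_iff hy
  proj_mem := (mem_precoders_iff _ _).mp
  payoff_lift := game2_payoff_diagPrecoder Γ
  payoff_update_lift_le hp q := game2_payoff_update_le (hΓ q) hp

end Payoffs

end LinkSystem

theorem theorem1 {Q N : ℕ} [NeZero N] (S : LinkSystem Q N) (Γ : Fin Q → ℝ)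
    (hΓ : ∀ q, 1 ≤ Γ q) :
    -- the diagonal precoders are admissible exactly when the power allocations are
    (∀ p : Fin Q → Fin N → ℝ, (∀ q k, 0 ≤ p q k) →
      ∀ q, S.diagPrecoder p q ∈ S.precoders q ↔ p q ∈ S.allocations q) ∧
    -- the two forms of the SINR
    (∀ (p : Fin Q → Fin N → ℝ) (q : Fin Q) (k : Fin N),
      S.sinr p q k = ‖S.normResp q q k‖ ^ 2 * p q k /
        (1 + ∑ r ∈ Finset.univ.erase q, ‖S.normResp r q k‖ ^ 2 * p r k)) ∧
    -- mutual information game: same payoffs, same optimal responses, same equilibria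
    ((∀ p : Fin Q → Fin N → ℝ, (∀ q k, 0 ≤ p q k) →
        (∀ q, S.game1.payoff q (S.diagPrecoder p) = (S.vectorGame 1).payoff q p) ∧
        (∀ q, S.game1.IsBestResponse (S.diagPrecoder p) q ↔
          (S.vectorGame 1).IsBestResponse p q) ∧
        (S.game1.IsNash (S.diagPrecoder p) ↔ (S.vectorGame 1).IsNash p)) ∧
      -- against diagonal precoders there is always a diagonal optimal precoder
      (∀ p : Fin Q → Fin N → ℝ, (∀ q, p q ∈ S.allocations q) → ∀ q, ∃ y : Fin N → ℝ,
        (S.vectorGame 1).IsBestResponse (Function.update p q y) q ∧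
        S.game1.IsBestResponse (S.diagPrecoder (Function.update p q y)) q)) ∧
    -- transmission rate game: the same, with rates in bits in the matrix game
    ((∀ p : Fin Q → Fin N → ℝ, (∀ q k, 0 ≤ p q k) →
        (∀ q, (S.game2 Γ).payoff q (S.diagPrecoder p) =
          (S.vectorGame Γ).payoff q p / Real.log 2) ∧
        (∀ q, (S.game2 Γ).IsBestResponse (S.diagPrecoder p) q ↔
          (S.vectorGame Γ).IsBestResponse p q) ∧
        ((S.game2 Γ).IsNash (S.diagPrecoder p) ↔ (S.vectorGame Γ).IsNash p)) ∧
      (∀ p : Fin Q → Fin N → ℝ, (∀ q, p q ∈ S.allocations q) → ∀ q, ∃ y : Fin N → ℝ,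
        (S.vectorGame Γ).IsBestResponse (Function.update p q y) q ∧
        (S.game2 Γ).IsBestResponse (S.diagPrecoder (Function.update p q y)) q)) := by
  have nonneg {p : Fin Q → Fin N → ℝ} (hp : ∀ q, p q ∈ S.allocations q) (q : Fin Q) (k : Fin N) :
      0 ≤ p q k := ((hp q).2 k).1
  have h₁ := S.game1_reducesTo_vectorGame
  have h₂ := S.game2_reducesTo_vectorGame hΓ
  refine ⟨fun p hp q => LinkSystem.diagPrecoder_mem_precoders_iff (hp q),
    LinkSystem.sinr_eq_normResp,
    ⟨fun p hp => ⟨h₁.payoff_lift hp, h₁.isBestResponse_iff hp, h₁.isNash_iff hp⟩,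
      fun p hp q => ?_⟩,
    ⟨fun p hp => ⟨h₂.payoff_lift hp, h₂.isBestResponse_iff hp, h₂.isNash_iff hp⟩,
      fun p hp q => ?_⟩⟩
  · obtain ⟨y, hy⟩ := LinkSystem.exists_isBestResponse_vectorGame (S := S) (Γ := 1) (q := q)
      one_pos (nonneg hp)
    exact ⟨y, hy, h₁.isBestResponse_lift_update (nonneg hp) hy⟩
  · obtain ⟨y, hy⟩ := LinkSystem.exists_isBestResponse_vectorGame (S := S) (q := q)
      (one_pos.trans_le (hΓ q)) (nonneg hp)
    exact ⟨y, hy, h₂.isBestResponse_lift_update (nonneg hp) hy⟩
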